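/- **Theorem 1.** Let $u_1,u_2,\dots$ be real random variables on a probability space and let $B$ be a standard Brownian motion, possibly on another probability space. Assume (A) $\{u_n\}$ is a (wide-sense) stationary sequence with $E(u_n)=0$ and finite variance; for some constant $0<\sigma<\infty$ we have $\sigma^2=\lim_{N\to\infty}E\big(N^{-1/2}\sum_{i=1}^N u_i\big)^2$, and the partial sum process $r\mapsto N^{-1/2}\sum_{i=1}^{\lfloor Nr\rfloor}u_i$, $r\in[0,1]$, converges weakly to $\sigma B$ in the Skorokhod space $D[0,1]$ as $N\to\infty$; (K) $K:\mathbb R\to[0,\infty)$ is a Lipschitz continuous probability density with mean $0$ and finite variance. Let $h=h_N>0$ satisfy $N/h_N\to\zeta\in[1,\infty)$ as $N\to\infty$. Under the null hypothesis of no drift, i.e. $Y_{n+1}=Y_n+u_n$ for $n\ge1$ with an arbitrary random starting value $Y_1$, put $K_h(z)=h^{-1}K(z/h)$ and $$\widehat m_n=\frac{\sum_{i=1}^{n}K_h(i-n)\,Y_i}{\sum_{i=1}^{n}K_h(i-n)},\qquad \widehat m_N(s)=\widehat m_{\lfloor Ns\rfloor},\quad s\in[0,1],$$ where, here and below, a quotient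 with denominator $0$ is read as $0$ (in particular $\widehat m_0=0$). Then, as $N\to\infty$, $$hN^{-3/2}\,\widehat m_N\ \xrightarrow{d}\ \frac{\sigma\int_0^1K(\zeta(r-1))B(r)\,dr}{\zeta\int_0^1K(\zeta(r-1))\,dr},$$ and the associated partial sum process converges weakly, $$hN^{-3/2}\,\widehat m_N(s)\ \Rightarrow\ \mathcal M_\zeta(s)=\frac{\sigma\int_0^sK(\zeta(r-s))B(r)\,dr}{\zeta\int_0^sK(\zeta(r-s))\,dr}\quad\text{in }D[0,1].$$ The limit process $\mathcal M_\zeta$ has continuous paths on $[0,1]$ with probability $1$. -/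

import Mathlib

open MeasureTheory ProbabilityTheory Filter Set
open scoped Topology ENNReal NNReal

namespace RandomWalkSmoother

/-! ### The Skorokhod space `D[0,1]` -/

/-- A function on `[0,1]` is càdlàg if it is right-continuous with left-hand limits. -/
def IsCadlag (x : unitInterval → ℝ) : Prop :=
  ∀ t : unitInterval, ContinuousWithinAt x (Ici t) t ∧ ∃ l : ℝ, Tendsto x (𝓝[<] t) (𝓝 l)

/-- The space `D[0,1]` of real càdlàg functions on `[0,1]`. -/
def Skorokhod : Type := {x : unitInterval → ℝ // IsCadlag x}

namespace Skorokhod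

instance : CoeFun Skorokhod (fun _ => unitInterval → ℝ) := ⟨fun x => x.1⟩

/-- The cost `max (sup_t |λ t - t|) (sup_t |x t - y (λ t)|)` of matching `x` with `y` through the
time change `l`, an increasing bijection (hence homeomorphism) of `[0,1]`. -/
noncomputable def cost (x y : Skorokhod) (l : unitInterval ≃o unitInterval) : ℝ≥0∞ :=
  max (⨆ t : unitInterval, edist t (l t)) (⨆ t : unitInterval, edist (x t) (y (l t)))

/-- The Skorokhod (`J₁`) distance: the infimum of the matching cost over all time changes. -/
noncomputable instance : EDist Skorokhod := ⟨fun x y => ⨅ l : unitInterval ≃o unitInterval, cost x y l⟩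

theorem edist_def (x y : Skorokhod) : edist x y = ⨅ l : unitInterval ≃o unitInterval, cost x y l := rfl

theorem cost_refl (x : Skorokhod) : cost x x (OrderIso.refl unitInterval) = 0 := by
  simp [cost]

theorem cost_symm (x y : Skorokhod) (l : unitInterval ≃o unitInterval) : cost y x l.symm = cost x y l := by
  unfold cost
  congr 1
  · rw [← l.toEquiv.iSup_comp]
    simp [edist_comm]
  · rw [← l.toEquiv.iSup_comp]
    simp [edist_comm]

theorem cost_trans (x y z : Skorokhod) (l k : unitInterval ≃o unitInterval) :
    cost x z (l.trans k) ≤ cost x y l + cost y z k := by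
  refine max_le (iSup_le fun t => ?_) (iSup_le fun t => ?_)
  · refine (edist_triangle t (l t) (k (l t))).trans (add_le_add ?_ ?_)
    · exact (le_iSup (fun t : unitInterval => edist t (l t)) t).trans (le_max_left _ _)
    · exact (le_iSup (fun t : unitInterval => edist t (k t)) (l t)).trans (le_max_left _ _)
  · refine (edist_triangle (x t) (y (l t)) (z (k (l t)))).trans (add_le_add ?_ ?_)
    · exact (le_iSup (fun t : unitInterval => edist (x t) (y (l t))) t).trans (le_max_right _ _)
    · exact (le_iSup (fun t : unitInterval => edist (y t) (z (k t))) (l t)).trans (le_max_right _ _)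

/-- The Skorokhod distance satisfies the axioms of a distance; it induces the Skorokhod topology. -/
noncomputable instance : PseudoEMetricSpace Skorokhod where
  edist_self x := by
    rw [edist_def]
    exact le_antisymm ((iInf_le _ (OrderIso.refl unitInterval)).trans (cost_refl x).le) bot_le
  edist_comm x y := by
    rw [edist_def, edist_def]
    apply le_antisymm
    · exact le_iInf fun l => (iInf_le _ l.symm).trans (cost_symm y x l).le
    · exact le_iInf fun l => (iInf_le _ l.symm).trans (cost_symm x y l).le
  edist_triangle x y z := by
    simp only [edist_def]
    exact ENNReal.le_iInf_add_iInf fun l k => (iInf_le _ (l.trans k)).trans (cost_trans x y z l k)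

/-- `D[0,1]` carries the Borel `σ`-algebra of the Skorokhod topology. -/
noncomputable instance : MeasurableSpace Skorokhod := borel Skorokhod

noncomputable instance : BorelSpace Skorokhod := ⟨rfl⟩

end Skorokhod

/-- Weak convergence `X N ⇒ Z` in `D[0,1]` of processes with index set `[0,1]`, written as
`X N ω s`: the paths are almost surely those of random elements of the Skorokhod space, and the
laws of these random elements converge weakly. -/
def TendstoWeaklyInD {Ω Ω' : Type*} [MeasurableSpace Ω] [MeasurableSpace Ω']
    (X : ℕ → Ω → unitInterval → ℝ) (Z : Ω' → unitInterval → ℝ)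
    (P : Measure Ω) [IsProbabilityMeasure P] (P' : Measure Ω') [IsProbabilityMeasure P'] : Prop :=
  ∃ (XD : ℕ → Ω → Skorokhod) (ZD : Ω' → Skorokhod),
    (∀ N, ∀ᵐ ω ∂P, ∀ s : unitInterval, XD N ω s = X N ω s) ∧
    (∀ᵐ ω ∂P', ∀ s : unitInterval, ZD ω s = Z ω s) ∧
    TendstoInDistribution XD atTop ZD (fun _ => P) P'

/-! ### Assumptions -/

/-- Assumption (A) on the innovations `u 1, u 2, …` with respect to the Brownian motion `B`. -/
structure AssumptionA {Ω Ω' : Type*} [MeasurableSpace Ω] [MeasurableSpace Ω']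
    (u : ℕ → Ω → ℝ) (σ : ℝ) (B : ℝ≥0 → Ω' → ℝ)
    (P : Measure Ω) [IsProbabilityMeasure P] (P' : Measure Ω') [IsProbabilityMeasure P'] :
    Prop where
  /-- Each innovation is a random variable with finite variance. -/
  memLp : ∀ n, 1 ≤ n → MemLp (u n) 2 P
  /-- The innovations are centered. -/
  mean_zero : ∀ n, 1 ≤ n → ∫ ω, u n ω ∂P = 0
  /-- The innovations are stationary: their covariances are invariant under time shifts. -/
  stationary : ∀ i j k, 1 ≤ i → 1 ≤ j →
    ∫ ω, u (i + k) ω * u (j + k) ω ∂P = ∫ ω, u i ω * u j ω ∂P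
  sigma_pos : 0 < σ
  /-- `σ²` is the long-run variance. -/
  sigma_sq : Tendsto
    (fun N : ℕ => ∫ ω, ((N : ℝ) ^ (-1 / 2 : ℝ) * ∑ i ∈ Finset.Icc 1 N, u i ω) ^ 2 ∂P)
    atTop (𝓝 (σ ^ 2))
  /-- The partial sum process converges weakly to `σ B` in `D[0,1]`. -/
  invariance : TendstoWeaklyInD
    (fun N ω r => (N : ℝ) ^ (-1 / 2 : ℝ) * ∑ i ∈ Finset.Icc 1 ⌊(N : ℝ) * (r : ℝ)⌋₊, u i ω)
    (fun ω r => σ * B (r : ℝ).toNNReal ω) P P'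

/-- Assumption (K): `K` is a Lipschitz continuous probability density with mean zero and finite
variance. -/
structure AssumptionK (K : ℝ → ℝ) : Prop where
  nonneg : ∀ z, 0 ≤ K z
  integrable : Integrable K
  integral_eq_one : ∫ z, K z = 1
  integrable_sq : Integrable fun z => z ^ 2 * K z
  mean_zero : ∫ z, z * K z = 0
  lipschitz : ∃ L : ℝ≥0, LipschitzWith L K

/-! ### The smoother and its limit -/

/-- The rescaled kernel `K_h(z) = h⁻¹ K(z / h)`. -/
noncomputable def rescaledKernel (K : ℝ → ℝ) (h z : ℝ) : ℝ := h⁻¹ * K (z / h)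

/-- The Nadaraya–Watson smoother `m̂_n` with bandwidth `h`, computed from `y 1, …, y n` observed at
the times `1, …, n`; it is `0` if the weights sum to `0`, in particular if `n = 0`. -/
noncomputable def smoother (K : ℝ → ℝ) (h : ℝ) (y : ℕ → ℝ) (n : ℕ) : ℝ :=
  (∑ i ∈ Finset.Icc 1 n, rescaledKernel K h ((i : ℝ) - (n : ℝ)) * y i) /
    ∑ i ∈ Finset.Icc 1 n, rescaledKernel K h ((i : ℝ) - (n : ℝ))

/-- The value at `s` of the limit process `M_ζ` along the path `b`; it is `0` if the denominator
is `0`, in particular if `s = 0`. -/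
noncomputable def limitProcess (K : ℝ → ℝ) (ζ σ : ℝ) (b : ℝ≥0 → ℝ) (s : ℝ) : ℝ :=
  (σ * ∫ r in (0 : ℝ)..s, K (ζ * (r - s)) * b r.toNNReal) /
    (ζ * ∫ r in (0 : ℝ)..s, K (ζ * (r - s)))

end RandomWalkSmoother

namespace RandomWalkSmoother

/-! ### Continuous convergence and the extended continuous mapping theorem -/

/-- Continuous convergence on a compact space forces the limit to be continuous and the
convergence to be uniform. -/
theorem continuous_and_tendstoUniformly_of_tendsto_prod {ι α : Type*} [TopologicalSpace α]
    [CompactSpace α] {p : Filter ι} [p.NeBot] {F : ι → α → ℝ} {f : α → ℝ}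
    (h : ∀ a, Tendsto (fun q : ι × α => F q.1 q.2) (p ×ˢ 𝓝 a) (𝓝 (f a))) :
    Continuous f ∧ TendstoUniformly F f p := by
  have h1 : ∀ a, Tendsto (fun i => F i a) p (𝓝 (f a)) := fun a =>
    (h a).comp (tendsto_id.prodMk (tendsto_const_nhds (x := a)))
  have hc : Continuous f := by
    refine continuous_iff_continuousAt.2 fun a => ?_
    refine Metric.tendsto_nhds.2 fun ε hε => ?_
    have h2 := Metric.tendsto_nhds.1 (h a) (ε / 2) (by positivity)
    obtain ⟨U, hU, V, hV, hUV⟩ := eventually_prod_iff.1 h2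
    filter_upwards [hV] with b hb
    have h3 : ∀ᶠ i in p, dist (F i b) (f a) ≤ ε / 2 := by
      filter_upwards [hU] with i hi using (hUV hi hb).le
    have h4 := le_of_tendsto ((h1 b).dist (tendsto_const_nhds (x := f a))) h3
    linarith
  refine ⟨hc, tendstoLocallyUniformly_iff_tendstoUniformly_of_compactSpace.1 ?_⟩
  refine tendstoLocallyUniformly_iff_forall_tendsto.2 fun a => ?_
  have h5 : Tendsto (fun q : ι × α => (f q.2, F q.1 q.2)) (p ×ˢ 𝓝 a) (𝓝 (f a, f a)) :=
    ((hc.tendsto a).comp tendsto_snd).prodMk_nhds (h a)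
  exact h5.mono_right (nhds_le_uniformity (f a))

/-- **Extended continuous mapping theorem** with an additional perturbation that vanishes in
probability: if `X N` converges in distribution to `Z`, and `g N x e` converges continuously to
the limit along `N → ∞`, `x → Z ω`, `e → 0`, then `g N (X N) (E N)` converges in distribution. -/
theorem tendstoInDistribution_of_continuous_convergence {Ω Ω' S T : Type*} [MeasurableSpace Ω]
    [MeasurableSpace Ω'] {P : Measure Ω} [IsProbabilityMeasure P] {P' : Measure Ω'}
    [IsProbabilityMeasure P'] [PseudoEMetricSpace S] [MeasurableSpace S] [BorelSpace S]
    [PseudoEMetricSpace T] [MeasurableSpace T] [BorelSpace T]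
    {X : ℕ → Ω → S} {Z : Ω' → S} (hX : TendstoInDistribution X atTop Z (fun _ => P) P')
    {E : ℕ → Ω → ℝ} (hE : TendstoInMeasure P E atTop 0)
    {g : ℕ → S → ℝ → T} {G : ℕ → Ω → T} {W : Ω' → T}
    (hG : ∀ N, AEMeasurable (G N) P) (hW : AEMeasurable W P')
    (hGg : ∀ N, ∀ᵐ ω ∂P, G N ω = g N (X N ω) (E N ω))
    (hg : ∀ᵐ ω ∂P', Tendsto (fun q : ℕ × S × ℝ => g q.1 q.2.1 q.2.2)
      (atTop ×ˢ 𝓝 (Z ω) ×ˢ 𝓝 0) (𝓝 (W ω))) :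
    TendstoInDistribution G atTop W (fun _ => P) P' := by
  refine ⟨hG, hW, tendsto_of_forall_isOpen_le_liminf' fun O hO => ?_⟩
  simp only [ProbabilityMeasure.coe_mk]
  rw [Measure.map_apply_of_aemeasurable hW hO.measurableSet]
  simp_rw [Measure.map_apply_of_aemeasurable (hG _) hO.measurableSet]
  set U : ℕ → Set S := fun k =>
    interior {x | ∀ N ≥ k, ∀ e : ℝ, |e| < 1 / ((k : ℝ) + 1) → g N x e ∈ O} with hU
  have hUmono : Monotone U := by
    refine fun k k' hk => interior_mono fun x hx N hN e he => hx N (hk.trans hN) e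
      (he.trans_le ?_)
    gcongr
  have hsub : W ⁻¹' O ≤ᵐ[P'] ⋃ k, Z ⁻¹' U k := by
    filter_upwards [hg] with ω hω hωO
    have h1 := hω (hO.mem_nhds hωO)
    rw [mem_map, mem_prod_iff] at h1
    obtain ⟨A, hA, V, hV, hAV⟩ := h1
    obtain ⟨V1, hV1, V2, hV2, hV12⟩ := mem_prod_iff.1 hV
    obtain ⟨N0, hN0⟩ := mem_atTop_sets.1 hA
    obtain ⟨δ, hδ, hδV⟩ := Metric.mem_nhds_iff.1 hV2
    obtain ⟨k0, hk0⟩ := exists_nat_one_div_lt hδ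
    refine mem_iUnion.2 ⟨max N0 k0, ?_⟩
    refine mem_interior_iff_mem_nhds.2 (mem_of_superset hV1 fun x hx N hN e he => ?_)
    refine hAV (mk_mem_prod (hN0 N (le_trans (le_max_left _ _) hN)) (hV12 (mk_mem_prod hx
      (hδV ?_))))
    rw [Metric.mem_ball, Real.dist_eq, sub_zero]
    refine he.trans (lt_of_le_of_lt ?_ hk0)
    gcongr
    exact le_max_right _ _
  have hlim : ∀ k, P' (Z ⁻¹' U k) ≤ liminf (fun N => P (G N ⁻¹' O)) atTop := by
    intro k
    have hUo : IsOpen (U k) := isOpen_interior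
    have h1 := ProbabilityMeasure.le_liminf_measure_open_of_tendsto hX.tendsto hUo
    simp only [ProbabilityMeasure.coe_mk] at h1
    rw [Measure.map_apply_of_aemeasurable hX.aemeasurable_limit hUo.measurableSet] at h1
    simp_rw [Measure.map_apply_of_aemeasurable (hX.forall_aemeasurable _) hUo.measurableSet] at h1
    refine h1.trans ?_
    set c : ℕ → ℝ≥0∞ := fun N => P {ω | 1 / ((k : ℝ) + 1) ≤ dist (E N ω) 0} with hc
    have hc0 : Tendsto c atTop (𝓝 0) := by
      have := tendstoInMeasure_iff_dist.1 hE (1 / ((k : ℝ) + 1)) (by positivity)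
      exact this
    have h2 : ∀ᶠ N in atTop, P (X N ⁻¹' U k) ≤ P (G N ⁻¹' O) + c N := by
      filter_upwards [eventually_ge_atTop k] with N hN
      refine (measure_mono_ae ?_).trans (measure_union_le _ _)
      filter_upwards [hGg N] with ω hω hωU
      by_cases he : 1 / ((k : ℝ) + 1) ≤ dist (E N ω) 0
      · exact Or.inr he
      · refine Or.inl ?_
        rw [not_le, Real.dist_eq, sub_zero] at he
        change G N ω ∈ O
        rw [hω]
        exact interior_subset hωU N hN _ he
    exact (liminf_le_liminf h2).trans (ENNReal.liminf_add_of_right_tendsto_zero hc0 _).le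
  calc P' (W ⁻¹' O) ≤ P' (⋃ k, Z ⁻¹' U k) := measure_mono_ae hsub
    _ = ⨆ k, P' (Z ⁻¹' U k) :=
        Monotone.measure_iUnion fun k k' hk => preimage_mono (hUmono hk)
    _ ≤ _ := iSup_le hlim

/-! ### Facts on the Skorokhod space -/

theorem isCadlag_of_continuous {x : unitInterval → ℝ} (hx : Continuous x) : IsCadlag x :=
  fun t => ⟨hx.continuousWithinAt, x t, (hx.tendsto t).mono_left nhdsWithin_le_nhds⟩

/-- A step function with jumps at multiples of `1 / N` is càdlàg. -/
theorem isCadlag_floor (N : ℕ) (w : ℕ → ℝ) :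
    IsCadlag fun s : unitInterval => w ⌊(N : ℝ) * (s : ℝ)⌋₊ := by
  intro t
  have hcont : Continuous fun s : unitInterval => (N : ℝ) * (s : ℝ) := by fun_prop
  have h0 : ∀ s : unitInterval, 0 ≤ (N : ℝ) * (s : ℝ) := fun s =>
    mul_nonneg (Nat.cast_nonneg _) s.2.1
  constructor
  · have h1 : ∀ᶠ s : unitInterval in 𝓝[Ici t] t,
        ⌊(N : ℝ) * (s : ℝ)⌋₊ = ⌊(N : ℝ) * (t : ℝ)⌋₊ := by
      have h2 : ∀ᶠ s : unitInterval in 𝓝[Ici t] t,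
          (N : ℝ) * (s : ℝ) < ⌊(N : ℝ) * (t : ℝ)⌋₊ + 1 :=
        nhdsWithin_le_nhds (hcont.tendsto t (Iio_mem_nhds (Nat.lt_floor_add_one _)))
      filter_upwards [h2, self_mem_nhdsWithin] with s hs hs'
      refine (Nat.floor_eq_iff (h0 s)).2 ⟨(Nat.floor_le (h0 t)).trans ?_, hs⟩
      exact mul_le_mul_of_nonneg_left hs' (Nat.cast_nonneg _)
    refine (tendsto_const_nhds (x := w ⌊(N : ℝ) * (t : ℝ)⌋₊)).congr' ?_
    filter_upwards [h1] with s hs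
    rw [hs]
  · refine ⟨w (⌈(N : ℝ) * (t : ℝ)⌉₊ - 1), ?_⟩
    refine (tendsto_const_nhds (x := w (⌈(N : ℝ) * (t : ℝ)⌉₊ - 1))).congr' ?_
    have h2 : ∀ᶠ s : unitInterval in 𝓝[<] t,
        (⌈(N : ℝ) * (t : ℝ)⌉₊ : ℝ) - 1 < (N : ℝ) * (s : ℝ) :=
      nhdsWithin_le_nhds (hcont.tendsto t (Ioi_mem_nhds
        (by linarith [Nat.ceil_lt_add_one (h0 t)])))
    filter_upwards [h2, self_mem_nhdsWithin] with s hs hs'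
    rcases Nat.eq_zero_or_pos N with rfl | hN
    · simp
    have h3 : (N : ℝ) * (s : ℝ) < (N : ℝ) * (t : ℝ) :=
      mul_lt_mul_of_pos_left hs' (Nat.cast_pos.2 hN)
    have h4 : 0 < ⌈(N : ℝ) * (t : ℝ)⌉₊ := Nat.ceil_pos.2 ((h0 s).trans_lt h3)
    congr 1
    symm
    refine (Nat.floor_eq_iff (h0 s)).2 ⟨?_, ?_⟩
    · rw [Nat.cast_sub h4, Nat.cast_one]
      exact hs.le
    · rw [Nat.cast_sub h4, Nat.cast_one]
      linarith [Nat.le_ceil ((N : ℝ) * (t : ℝ))]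

/-- The path that takes the value `w ⌊N s⌋` at `s`. -/
noncomputable def stepPath (N : ℕ) (w : ℕ → ℝ) : Skorokhod := ⟨_, isCadlag_floor N w⟩

theorem floor_mul_le (N : ℕ) (s : unitInterval) : ⌊(N : ℝ) * (s : ℝ)⌋₊ ≤ N :=
  Nat.floor_le_of_le (mul_le_of_le_one_right (Nat.cast_nonneg _) s.2.2)

/-- The Skorokhod distance is dominated by the uniform distance. -/
theorem Skorokhod.edist_le_of_forall {x y : Skorokhod} {c : ℝ≥0∞}
    (h : ∀ s : unitInterval, edist (x s) (y s) ≤ c) : edist x y ≤ c := by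
  rw [Skorokhod.edist_def]
  refine (iInf_le _ (OrderIso.refl unitInterval)).trans (max_le ?_ (iSup_le h))
  simp

theorem Skorokhod.tendsto_of_tendstoUniformly {ι : Type*} {p : Filter ι} {F : ι → Skorokhod}
    {x : Skorokhod} (h : TendstoUniformly (fun i => (F i : unitInterval → ℝ)) x p) :
    Tendsto F p (𝓝 x) := by
  refine EMetric.tendsto_nhds.2 fun ε hε => ?_
  obtain ⟨δ, hδ, hδε⟩ := exists_between hε
  filter_upwards [EMetric.tendstoUniformly_iff.1 h δ hδ] with i hi
  exact (Skorokhod.edist_le_of_forall fun s => (edist_comm (F i s) (x s)).trans_le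
    (hi s).le).trans_lt hδε

/-- Skorokhod convergence to a continuous path is uniform. -/
theorem Skorokhod.eventually_forall_abs_sub_lt {x : Skorokhod} (hx : Continuous x.1) {ε : ℝ}
    (hε : 0 < ε) : ∀ᶠ y : Skorokhod in 𝓝 x, ∀ s : unitInterval, |y s - x s| < ε := by
  obtain ⟨δ, hδ, hδx⟩ := Metric.uniformContinuous_iff.1
    (CompactSpace.uniformContinuous_of_continuous hx) (ε / 2) (by positivity)
  have hpos : 0 < ENNReal.ofReal (min δ (ε / 2)) := ENNReal.ofReal_pos.2 (by positivity)
  filter_upwards [Metric.eball_mem_nhds x hpos] with y hy s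
  rw [Metric.mem_eball, edist_comm, Skorokhod.edist_def, iInf_lt_iff] at hy
  obtain ⟨l, hl⟩ := hy
  have h1 : edist (l.symm s) s < ENNReal.ofReal (min δ (ε / 2)) := by
    refine lt_of_le_of_lt ?_ hl
    refine le_trans ?_ (le_max_left _ _)
    simpa using le_iSup (fun t : unitInterval => edist t (l t)) (l.symm s)
  have h2 : edist (x (l.symm s)) (y s) < ENNReal.ofReal (min δ (ε / 2)) := by
    refine lt_of_le_of_lt ?_ hl
    refine le_trans ?_ (le_max_right _ _)
    simpa using le_iSup (fun t : unitInterval => edist (x t) (y (l t))) (l.symm s)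
  rw [edist_lt_ofReal] at h1 h2
  have h3 := hδx (h1.trans_le (min_le_left _ _))
  have h4 := h2.trans_le (min_le_right _ _)
  rw [← Real.dist_eq]
  calc dist (y s) (x s) ≤ dist (y s) (x (l.symm s)) + dist (x (l.symm s)) (x s) :=
        dist_triangle _ _ _
    _ < ε := by rw [dist_comm (y s)]; linarith

theorem Skorokhod.continuous_eval_one : Continuous fun x : Skorokhod => x 1 := by
  refine LipschitzWith.continuous (K := 1) fun x y => ?_
  rw [ENNReal.coe_one, one_mul, Skorokhod.edist_def]
  refine le_iInf fun l => le_trans ?_ (le_max_right _ _)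
  have h1 : l 1 = 1 := l.map_top
  simpa [h1] using le_iSup (fun t : unitInterval => edist (x t) (y (l t))) 1

theorem aemeasurable_stepPath {Ω : Type*} [MeasurableSpace Ω] {P : Measure Ω} (N : ℕ)
    {w : ℕ → Ω → ℝ} (hw : ∀ n, AEMeasurable (w n) P) :
    AEMeasurable (fun ω => stepPath N fun n => w n ω) P := by
  set F : (Fin (N + 1) → ℝ) → Skorokhod := fun v => stepPath N fun n => v (Fin.ofNat (N + 1) n)
  have hF : Continuous F := by
    refine LipschitzWith.continuous (K := 1) fun v v' => ?_
    rw [ENNReal.coe_one, one_mul]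
    exact Skorokhod.edist_le_of_forall fun s => edist_le_pi_edist v v' _
  have h1 : AEMeasurable (fun ω (n : Fin (N + 1)) => w n ω) P :=
    aemeasurable_pi_lambda _ fun n => hw n
  refine (hF.measurable.comp_aemeasurable h1).congr (Eventually.of_forall fun ω => ?_)
  refine Subtype.ext (funext fun s => ?_)
  change w ((⌊(N : ℝ) * (s : ℝ)⌋₊) % (N + 1)) ω = w ⌊(N : ℝ) * (s : ℝ)⌋₊ ω
  rw [Nat.mod_eq_of_lt (Nat.lt_succ_of_le (floor_mul_le N s))]

/-! ### Convergence of kernel averages -/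

theorem tendsto_riemann_sum {ι : Type*} {p : Filter ι} {G : ℝ → ℝ} (hG : Continuous G)
    {N n : ι → ℕ} {a : ι → ℕ → ℝ} {s : ℝ} (hN : Tendsto N p atTop)
    (hn : ∀ᶠ i in p, n i ≤ N i) (hs : Tendsto (fun i => (n i : ℝ) / N i) p (𝓝 s))
    (ha : ∀ ε > 0, ∀ᶠ i in p, ∀ j < n i, |a i j - G (j / N i)| ≤ ε) :
    Tendsto (fun i => (N i : ℝ)⁻¹ * ∑ j ∈ Finset.range (n i), a i j) p
      (𝓝 (∫ r in (0 : ℝ)..s, G r)) := by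
  have hint : ∀ a b : ℝ, IntervalIntegrable G volume a b := fun a b => hG.intervalIntegrable a b
  have h1 : Tendsto (fun i => ∫ r in (0 : ℝ)..((n i : ℝ) / N i), G r) p
      (𝓝 (∫ r in (0 : ℝ)..s, G r)) :=
    ((intervalIntegral.continuous_primitive hint 0).tendsto s).comp hs
  suffices h2 : Tendsto (fun i => (N i : ℝ)⁻¹ * ∑ j ∈ Finset.range (n i), a i j -
      ∫ r in (0 : ℝ)..((n i : ℝ) / N i), G r) p (𝓝 0) by
    simpa using h2.add h1
  refine Metric.tendsto_nhds.2 fun ε hε => ?_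
  have huc := (isCompact_Icc (a := (0 : ℝ)) (b := 1)).uniformContinuousOn_of_continuous
    hG.continuousOn
  obtain ⟨δ, hδ, hδG⟩ := Metric.uniformContinuousOn_iff.1 huc (ε / 4) (by positivity)
  have hNδ : ∀ᶠ i in p, 1 / (N i : ℝ) < δ :=
    (tendsto_one_div_atTop_nhds_zero_nat.comp hN).eventually (Iio_mem_nhds hδ)
  filter_upwards [ha (ε / 4) (by positivity), hNδ, hn, hN.eventually (eventually_ge_atTop 1)]
    with i hai hi hni hi1
  have hN0 : (0 : ℝ) < N i := by exact_mod_cast hi1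
  rw [dist_zero_right]
  have h3 := intervalIntegral.sum_integral_adjacent_intervals (μ := volume) (f := G)
    (a := fun k : ℕ => (k : ℝ) / N i) (n := n i) fun k _ => hint _ _
  simp only [Nat.cast_zero, zero_div] at h3
  rw [← h3, Finset.mul_sum, ← Finset.sum_sub_distrib]
  have h4 : ∀ j ∈ Finset.range (n i), ‖(N i : ℝ)⁻¹ * a i j -
      ∫ r in ((j : ℝ) / N i)..((j + 1 : ℕ) : ℝ) / N i, G r‖ ≤ ε / 2 * (N i : ℝ)⁻¹ := by
    intro j hj
    rw [Finset.mem_range] at hj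
    have hlen : ((j + 1 : ℕ) : ℝ) / N i - (j : ℝ) / N i = (N i : ℝ)⁻¹ := by
      push_cast
      field_simp
      ring
    have hle : (j : ℝ) / N i ≤ ((j + 1 : ℕ) : ℝ) / N i := by
      rw [← sub_nonneg, hlen]
      positivity
    have hup : ((j + 1 : ℕ) : ℝ) / N i ≤ 1 :=
      (div_le_one hN0).2 (by exact_mod_cast (Nat.succ_le_of_lt hj).trans hni)
    have h5 : (N i : ℝ)⁻¹ * a i j = ∫ r in ((j : ℝ) / N i)..((j + 1 : ℕ) : ℝ) / N i, a i j := by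
      rw [intervalIntegral.integral_const, hlen, smul_eq_mul]
    rw [h5, ← intervalIntegral.integral_sub (by simp) (hint _ _)]
    refine (intervalIntegral.norm_integral_le_of_norm_le_const (C := ε / 2) ?_).trans ?_
    · intro r hr
      rw [uIoc_of_le hle] at hr
      have h0 : (0 : ℝ) ≤ (j : ℝ) / N i := by positivity
      have h6 := hδG ((j : ℝ) / N i) ⟨h0, hle.trans hup⟩ r ⟨h0.trans hr.1.le, hr.2.trans hup⟩
        (by
          rw [dist_comm, Real.dist_eq, abs_of_nonneg (by linarith [hr.1])]
          have := hr.2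
          rw [one_div] at hi
          linarith)
      rw [Real.dist_eq] at h6
      rw [Real.norm_eq_abs]
      have h7 := abs_sub_le (a i j) (G (j / N i)) (G r)
      linarith [hai j hj]
    · rw [hlen, abs_of_pos (by positivity)]
  calc ‖_‖ ≤ ∑ j ∈ Finset.range (n i), ε / 2 * (N i : ℝ)⁻¹ := norm_sum_le_of_le _ h4
    _ = ε / 2 * (n i / N i) := by
        rw [Finset.sum_const, Finset.card_range, nsmul_eq_mul]
        ring
    _ ≤ ε / 2 * 1 := by
        gcongr
        exact (div_le_one hN0).2 (by exact_mod_cast hni)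
    _ < ε := by linarith

theorem abs_sum_mul_div_sum_le {α : Type*} {t : Finset α} {w v : α → ℝ} {c : ℝ} (hc : 0 ≤ c)
    (hw : ∀ j ∈ t, 0 ≤ w j) (hv : ∀ j ∈ t, w j ≠ 0 → |v j| ≤ c) :
    |(∑ j ∈ t, w j * v j) / ∑ j ∈ t, w j| ≤ c := by
  have hs : 0 ≤ ∑ j ∈ t, w j := Finset.sum_nonneg hw
  rw [abs_div, abs_of_nonneg hs]
  refine div_le_of_le_mul₀ hs hc ?_
  rw [Finset.mul_sum]
  refine (Finset.abs_sum_le_sum_abs _ _).trans (Finset.sum_le_sum fun j hj => ?_)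
  rw [abs_mul, abs_of_nonneg (hw j hj)]
  rcases eq_or_ne (w j) 0 with h | h
  · simp [h]
  · rw [mul_comm c]
    exact mul_le_mul_of_nonneg_left (hv j hj h) (hw j hj)

theorem kernel_uniform_approx {ι : Type*} {p : Filter ι} {K : ℝ → ℝ} {L : ℝ≥0}
    (hL : LipschitzWith L K) {N n : ι → ℕ} {h : ι → ℝ} {s ζ : ℝ} (hζ : 0 < ζ)
    (hN : Tendsto N p atTop) (hn : ∀ᶠ i in p, n i ≤ N i)
    (hs : Tendsto (fun i => (n i : ℝ) / N i) p (𝓝 s))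
    (hh : Tendsto (fun i => (N i : ℝ) / h i) p (𝓝 ζ)) {ε : ℝ} (hε : 0 < ε) :
    ∀ᶠ i in p, ∀ j < n i,
      |K (((j : ℝ) + 1 - n i) / h i) - K (ζ * ((j : ℝ) / N i - s))| ≤ ε := by
  have h1 : Tendsto (fun i => (L : ℝ) * (|(N i : ℝ) / h i - ζ| +
      ζ * (1 / (N i : ℝ) + |(n i : ℝ) / N i - s|))) p (𝓝 0) := by
    have hA : Tendsto (fun i => |(N i : ℝ) / h i - ζ|) p (𝓝 0) := by
      simpa using (hh.sub_const ζ).abs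
    have hB : Tendsto (fun i => |(n i : ℝ) / N i - s|) p (𝓝 0) := by
      simpa using (hs.sub_const s).abs
    have hC : Tendsto (fun i => 1 / (N i : ℝ)) p (𝓝 0) :=
      tendsto_one_div_atTop_nhds_zero_nat.comp hN
    simpa using (hA.add ((hC.add hB).const_mul ζ)).const_mul (L : ℝ)
  filter_upwards [h1.eventually_le_const hε, hn, hN.eventually (eventually_ge_atTop 1)]
    with i hi hni hi1 j hj
  have hN0 : (0 : ℝ) < N i := by exact_mod_cast hi1
  refine le_trans ?_ hi
  have h2 := hL.dist_le_mul (((j : ℝ) + 1 - n i) / h i) (ζ * ((j : ℝ) / N i - s))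
  rw [Real.dist_eq, Real.dist_eq] at h2
  refine h2.trans (mul_le_mul_of_nonneg_left ?_ L.2)
  have h3 : ((j : ℝ) + 1 - n i) / h i - ζ * ((j : ℝ) / N i - s) =
      ((N i : ℝ) / h i - ζ) * (((j : ℝ) + 1 - n i) / N i) +
        ζ * (1 / (N i : ℝ) - ((n i : ℝ) / N i - s)) := by
    rw [sub_mul, div_mul_div_cancel₀' hN0.ne']
    ring
  have hj1 : (j : ℝ) + 1 ≤ n i := by exact_mod_cast hj
  have hn1 : (n i : ℝ) ≤ N i := by exact_mod_cast hni
  have h4 : |((j : ℝ) + 1 - n i) / N i| ≤ 1 := by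
    rw [abs_le, le_div_iff₀ hN0, div_le_iff₀ hN0]
    constructor <;> linarith [(Nat.cast_nonneg j : (0 : ℝ) ≤ j)]
  rw [h3]
  refine (abs_add_le _ _).trans (add_le_add ?_ ?_)
  · rw [abs_mul]
    exact mul_le_of_le_one_right (abs_nonneg _) h4
  · rw [abs_mul, abs_of_pos hζ]
    refine mul_le_mul_of_nonneg_left ((abs_sub _ _).trans ?_) hζ.le
    rw [abs_of_pos (by positivity : 0 < 1 / (N i : ℝ))]

/-- If the limiting total kernel mass is zero, the kernel vanishes up to the horizon. -/
theorem le_of_kernel_ne_zero {K : ℝ → ℝ} (hK0 : ∀ z, 0 ≤ K z) (hKc : Continuous K) {s ζ : ℝ}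
    (hζ : 0 < ζ) (hs : 0 ≤ s) (hD : ∫ r in (0 : ℝ)..s, K (ζ * (r - s)) = 0) {v : ℝ} (hv : 0 ≤ v)
    (hKv : K (-v) ≠ 0) : ζ * s ≤ v := by
  by_contra! hlt
  have hs' : 0 < s := by
    rcases hs.eq_or_lt with h | h
    · rw [← h] at hlt
      linarith
    · exact h
  refine (intervalIntegral.integral_pos hs' (by fun_prop) (fun r _ => hK0 _)
    ⟨s - v / ζ, ⟨?_, ?_⟩, ?_⟩).ne' hD
  · rw [sub_nonneg, div_le_iff₀ hζ]
    linarith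
  · linarith [div_nonneg hv hζ.le]
  · have : ζ * (s - v / ζ - s) = -v := by
      field_simp
      ring
    rw [this]
    exact lt_of_le_of_ne (hK0 _) (Ne.symm hKv)

/-- Continuous convergence of kernel averages of a path that is uniformly approximated by a
continuous path starting at zero. -/
theorem tendsto_kernel_average {ι : Type*} {p : Filter ι} {K : ℝ → ℝ} (hK0 : ∀ z, 0 ≤ K z)
    {L : ℝ≥0} (hL : LipschitzWith L K) {N n : ι → ℕ} {h : ι → ℝ} {s ζ : ℝ} (hζ : 0 < ζ)
    (h_pos : ∀ i, 0 < h i) (hs0 : 0 ≤ s)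
    (hN : Tendsto N p atTop) (hn : ∀ᶠ i in p, n i ≤ N i)
    (hs : Tendsto (fun i => (n i : ℝ) / N i) p (𝓝 s))
    (hh : Tendsto (fun i => (N i : ℝ) / h i) p (𝓝 ζ)) {b : ι → ℕ → ℝ} {f : ℝ → ℝ}
    (hf : Continuous f) (hf0 : f 0 = 0)
    (hb : ∀ ε > 0, ∀ᶠ i in p, ∀ j < n i, |b i j - f (j / N i)| ≤ ε) :
    Tendsto (fun i => h i / N i *
      ((∑ j ∈ Finset.range (n i), K (((j : ℝ) + 1 - n i) / h i) * b i j) /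
        ∑ j ∈ Finset.range (n i), K (((j : ℝ) + 1 - n i) / h i))) p
      (𝓝 ((∫ r in (0 : ℝ)..s, K (ζ * (r - s)) * f r) /
        (ζ * ∫ r in (0 : ℝ)..s, K (ζ * (r - s))))) := by
  have hKc : Continuous K := hL.continuous
  have hζi : Tendsto (fun i => h i / N i) p (𝓝 ζ⁻¹) := by
    simpa using hh.inv₀ hζ.ne'
  have hN1 : ∀ᶠ i in p, 0 < (N i : ℝ) := by
    filter_upwards [hN.eventually (eventually_ge_atTop 1)] with i hi
    exact_mod_cast hi
  have hK' := fun {ε : ℝ} (hε : 0 < ε) => kernel_uniform_approx hL hζ hN hn hs hh hε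
  by_cases hD : ∫ r in (0 : ℝ)..s, K (ζ * (r - s)) = 0
  · rw [hD, mul_zero, div_zero]
    rw [← mul_zero ζ⁻¹]
    refine hζi.mul ?_
    refine Metric.tendsto_nhds.2 fun ε hε => ?_
    obtain ⟨δ, hδ, hδf⟩ := Metric.continuous_iff.1 hf 0 (ε / 4) (by positivity)
    have hη : Tendsto (fun i => (n i : ℝ) / N i - h i / N i * (ζ * s)) p (𝓝 0) := by
      have := hs.sub (hζi.mul_const (ζ * s))
      rwa [inv_mul_cancel_left₀ hζ.ne', sub_self] at this
    filter_upwards [hη.eventually (Iio_mem_nhds hδ), hb (ε / 4) (by positivity), hN1]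
      with i hi hbi hi1
    rw [dist_zero_right, Real.norm_eq_abs]
    refine lt_of_le_of_lt (abs_sum_mul_div_sum_le (c := ε / 2) (by positivity)
      (fun j _ => hK0 _) fun j hj hKj => ?_) (by linarith)
    rw [Finset.mem_range] at hj
    have hj1 : (j : ℝ) + 1 ≤ n i := by exact_mod_cast hj
    have h1 : ζ * s ≤ ((n i : ℝ) - j - 1) / h i := by
      refine le_of_kernel_ne_zero hK0 hKc hζ hs0 hD
        (div_nonneg (by linarith) (h_pos i).le) ?_
      convert hKj using 2
      ring
    rw [le_div_iff₀ (h_pos i)] at h1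
    have h2 : (j : ℝ) / N i < δ := by
      refine lt_of_le_of_lt ?_ hi
      rw [← sub_nonneg]
      have : (n i : ℝ) / N i - h i / N i * (ζ * s) - j / N i =
          ((n i : ℝ) - j - ζ * s * h i) / N i := by ring
      rw [this]
      exact div_nonneg (by linarith) hi1.le
    have h3 := hδf ((j : ℝ) / N i) (by rwa [dist_zero_right, Real.norm_of_nonneg (by positivity)])
    rw [hf0, dist_zero_right, Real.norm_eq_abs] at h3
    have h4 := abs_sub_abs_le_abs_sub (b i j) (f (j / N i))
    linarith [hbi j hj]
  · have hden := tendsto_riemann_sum (G := fun r => K (ζ * (r - s))) (by fun_prop) hN hn hs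
      (a := fun i j => K (((j : ℝ) + 1 - n i) / h i)) fun ε hε => hK' hε
    obtain ⟨M, hM⟩ := (isCompact_Icc (a := (0 : ℝ)) (b := 1)).exists_bound_of_continuousOn
      hf.continuousOn
    obtain ⟨M', hM'⟩ := (isCompact_Icc (a := (0 : ℝ)) (b := 1)).exists_bound_of_continuousOn
      (f := fun r => K (ζ * (r - s))) (by fun_prop)
    have hM0 : 0 ≤ M := (norm_nonneg _).trans (hM 0 (by simp))
    have hM0' : 0 ≤ M' := (norm_nonneg _).trans (hM' 0 (by simp))
    have hnum := tendsto_riemann_sum (G := fun r => K (ζ * (r - s)) * f r) (by fun_prop) hN hn hs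
      (a := fun i j => K (((j : ℝ) + 1 - n i) / h i) * b i j) (by
        intro ε hε
        have hε1 : 0 < ε / (2 * (M + 1)) := by positivity
        have hε2 : 0 < min 1 (ε / (2 * (M' + 1))) := by positivity
        filter_upwards [hK' hε1, hb _ hε2, hN1, hn] with i h1 h2 hi1 hni j hj
        have hmem : (j : ℝ) / N i ∈ Icc (0 : ℝ) 1 :=
          ⟨by positivity, (div_le_one hi1).2 (by exact_mod_cast hj.le.trans hni)⟩
        have e1 := h1 j hj
        have e2 := (h2 j hj).trans (min_le_left _ _)
        have e3 := (h2 j hj).trans (min_le_right _ _)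
        have e4 := hM _ hmem
        have e5 := hM' _ hmem
        rw [Real.norm_eq_abs] at e4 e5
        have e6 : |b i j| ≤ M + 1 := by
          have := abs_sub_abs_le_abs_sub (b i j) (f (j / N i))
          linarith
        set k := K (((j : ℝ) + 1 - n i) / h i)
        set k' := K (ζ * ((j : ℝ) / N i - s))
        have e7 : k * b i j - k' * f (j / N i) = (k - k') * b i j + k' * (b i j - f (j / N i)) := by
          ring
        rw [e7]
        calc _ ≤ |k - k'| * |b i j| + |k'| * |b i j - f (j / N i)| := by
              rw [← abs_mul, ← abs_mul]
              exact abs_add_le _ _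
          _ ≤ ε / (2 * (M + 1)) * (M + 1) + (M' + 1) * (ε / (2 * (M' + 1))) := by
              gcongr
              linarith
          _ = ε := by field_simp; ring)
    have h5 := hζi.mul (hnum.div hden hD)
    rw [show ((∫ r in (0 : ℝ)..s, K (ζ * (r - s)) * f r) /
        (ζ * ∫ r in (0 : ℝ)..s, K (ζ * (r - s)))) = ζ⁻¹ *
        ((∫ r in (0 : ℝ)..s, K (ζ * (r - s)) * f r) / ∫ r in (0 : ℝ)..s, K (ζ * (r - s))) by
      rw [mul_comm ζ, ← div_div]; ring]
    refine h5.congr' ?_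
    filter_upwards [hN1] with i hi
    simp only [Pi.div_apply]
    rw [mul_div_mul_left _ _ (inv_ne_zero hi.ne')]

/-! ### The rescaled smoother as a random element of the Skorokhod space -/

theorem smoother_eq (K : ℝ → ℝ) {h : ℝ} (hh : 0 < h) (y : ℕ → ℝ) (n : ℕ) :
    smoother K h y n = (∑ j ∈ Finset.range n, K (((j : ℝ) + 1 - n) / h) * y (j + 1)) /
      ∑ j ∈ Finset.range n, K (((j : ℝ) + 1 - n) / h) := by
  have hsum : ∀ f : ℕ → ℝ, ∑ i ∈ Finset.Icc 1 n, f i = ∑ j ∈ Finset.range n, f (j + 1) := by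
    intro f
    rw [← Finset.Ico_add_one_right_eq_Icc, Finset.sum_Ico_eq_sum_range]
    simp [add_comm]
  unfold smoother rescaledKernel
  rw [hsum, hsum]
  simp only [mul_assoc, ← Finset.mul_sum, Nat.cast_add, Nat.cast_one]
  rw [mul_div_mul_left _ _ (inv_ne_zero hh.ne')]

theorem smoother_congr (K : ℝ → ℝ) (h : ℝ) {y y' : ℕ → ℝ} {n : ℕ}
    (hy : ∀ i, 1 ≤ i → i ≤ n → y i = y' i) : smoother K h y n = smoother K h y' n := by
  unfold smoother
  congr 1
  refine Finset.sum_congr rfl fun i hi => ?_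
  rw [Finset.mem_Icc] at hi
  rw [hy i hi.1 hi.2]

theorem aemeasurable_smoother {Ω : Type*} [MeasurableSpace Ω] {P : Measure Ω} (K : ℝ → ℝ) (h : ℝ)
    {y : ℕ → Ω → ℝ} (hy : ∀ i, 1 ≤ i → AEMeasurable (y i) P) (n : ℕ) :
    AEMeasurable (fun ω => smoother K h (fun i => y i ω) n) P := by
  unfold smoother
  refine AEMeasurable.div_const (Finset.aemeasurable_fun_sum _ fun i hi => ?_) _
  exact (hy i (Finset.mem_Icc.1 hi).1).const_mul _

/-- The path `s ↦ h N^{-3/2} m̂_{⌊N s⌋}` computed from the observations `y`. -/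
noncomputable def smootherPath (K : ℝ → ℝ) (h : ℝ) (N : ℕ) (y : ℕ → ℝ) : Skorokhod :=
  stepPath N fun n => h * (N : ℝ) ^ (-3 / 2 : ℝ) * smoother K h y n

theorem smootherPath_apply (K : ℝ → ℝ) (h : ℝ) (N : ℕ) (y : ℕ → ℝ) (s : unitInterval) :
    smootherPath K h N y s =
      h * (N : ℝ) ^ (-3 / 2 : ℝ) * smoother K h y ⌊(N : ℝ) * (s : ℝ)⌋₊ := rfl

theorem smootherPath_congr (K : ℝ → ℝ) (h : ℝ) {N : ℕ} {y y' : ℕ → ℝ}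
    (hy : ∀ i, 1 ≤ i → i ≤ N → y i = y' i) : smootherPath K h N y = smootherPath K h N y' := by
  refine Subtype.ext (funext fun s => ?_)
  rw [smootherPath_apply, smootherPath_apply,
    smoother_congr K h fun i h1 hi => hy i h1 (hi.trans (floor_mul_le N s))]

theorem aemeasurable_smootherPath {Ω : Type*} [MeasurableSpace Ω] {P : Measure Ω} (K : ℝ → ℝ)
    (h : ℝ) (N : ℕ) {y : ℕ → Ω → ℝ} (hy : ∀ i, 1 ≤ i → AEMeasurable (y i) P) :
    AEMeasurable (fun ω => smootherPath K h N fun i => y i ω) P :=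
  aemeasurable_stepPath N fun n => (aemeasurable_smoother K h hy n).const_mul _

/-- The observations at the times `1, 2, …` whose rescaled path is `x + e`. -/
noncomputable def observations (N : ℕ) (x : Skorokhod) (e : ℝ) (i : ℕ) : ℝ :=
  (N : ℝ) ^ (1 / 2 : ℝ) * (x (projIcc 0 1 zero_le_one (((i : ℝ) - 1) / N)) + e)

theorem smootherPath_observations_apply (K : ℝ → ℝ) {h : ℝ} (hh : 0 < h) {N : ℕ} (hN : 1 ≤ N)
    (x : Skorokhod) (e : ℝ) (s : unitInterval) :
    smootherPath K h N (observations N x e) s = h / N *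
      ((∑ j ∈ Finset.range ⌊(N : ℝ) * (s : ℝ)⌋₊,
          K (((j : ℝ) + 1 - ⌊(N : ℝ) * (s : ℝ)⌋₊) / h) *
            (x (projIcc 0 1 zero_le_one ((j : ℝ) / N)) + e)) /
        ∑ j ∈ Finset.range ⌊(N : ℝ) * (s : ℝ)⌋₊,
          K (((j : ℝ) + 1 - ⌊(N : ℝ) * (s : ℝ)⌋₊) / h)) := by
  have hN0 : (0 : ℝ) < N := by exact_mod_cast hN
  rw [smootherPath_apply, smoother_eq K hh]
  simp only [observations, Nat.cast_add, Nat.cast_one, add_sub_cancel_right,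
    mul_left_comm (K _), ← Finset.mul_sum]
  have h1 : (N : ℝ) ^ (-3 / 2 : ℝ) * (N : ℝ) ^ (1 / 2 : ℝ) = (N : ℝ)⁻¹ := by
    rw [← Real.rpow_add hN0, ← Real.rpow_neg_one]
    norm_num
  rw [mul_div_assoc, mul_assoc, ← mul_assoc ((N : ℝ) ^ (-3 / 2 : ℝ)), h1, ← mul_assoc,
    div_eq_mul_inv h]

theorem tendsto_floor_mul_div {ι : Type*} {p : Filter ι} {N : ι → ℕ} {t : ι → unitInterval}
    {s : unitInterval} (hN : Tendsto N p atTop) (ht : Tendsto t p (𝓝 s)) :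
    Tendsto (fun i => (⌊(N i : ℝ) * (t i : ℝ)⌋₊ : ℝ) / N i) p (𝓝 (s : ℝ)) := by
  have ht' : Tendsto (fun i => (t i : ℝ)) p (𝓝 (s : ℝ)) :=
    (continuous_subtype_val.tendsto s).comp ht
  have hC : Tendsto (fun i => 1 / (N i : ℝ)) p (𝓝 0) :=
    tendsto_one_div_atTop_nhds_zero_nat.comp hN
  have hlow : Tendsto (fun i => (t i : ℝ) - 1 / (N i : ℝ)) p (𝓝 (s : ℝ)) := by
    simpa using ht'.sub hC
  have hN1 := hN.eventually (eventually_ge_atTop 1)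
  refine tendsto_of_tendsto_of_tendsto_of_le_of_le' hlow ht' ?_ ?_
  · filter_upwards [hN1] with i hi
    have hN0 : (0 : ℝ) < N i := by exact_mod_cast hi
    rw [le_div_iff₀ hN0, sub_mul, one_div_mul_cancel hN0.ne', mul_comm]
    exact (Nat.sub_one_lt_floor _).le
  · filter_upwards [hN1] with i hi
    have hN0 : (0 : ℝ) < N i := by exact_mod_cast hi
    rw [div_le_iff₀ hN0, mul_comm (t i : ℝ)]
    exact Nat.floor_le (mul_nonneg hN0.le (t i).2.1)

/-- Continuous convergence of the smoother at a continuous path `x = σ b` that starts at zero: the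
limit path is continuous and the convergence is uniform. -/
theorem continuous_limitProcess_and_tendstoUniformly {K : ℝ → ℝ} (hK : AssumptionK K) {h : ℕ → ℝ}
    (h_pos : ∀ N, 0 < h N) {ζ : ℝ} (hζ : 0 < ζ)
    (h_lim : Tendsto (fun N : ℕ => (N : ℝ) / h N) atTop (𝓝 ζ)) {σ : ℝ} {b : ℝ≥0 → ℝ}
    (hb : Continuous b) (hb0 : b 0 = 0) {x : Skorokhod}
    (hx : ∀ s : unitInterval, x s = σ * b (s : ℝ).toNNReal) :
    Continuous (fun s : unitInterval => limitProcess K ζ σ b s) ∧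
      TendstoUniformly (fun (q : ℕ × Skorokhod × ℝ) (s : unitInterval) =>
          smootherPath K (h q.1) q.1 (observations q.1 q.2.1 q.2.2) s)
        (fun s : unitInterval => limitProcess K ζ σ b s) (atTop ×ˢ 𝓝 x ×ˢ 𝓝 0) := by
  refine continuous_and_tendstoUniformly_of_tendsto_prod fun s => ?_
  set p : Filter ((ℕ × Skorokhod × ℝ) × unitInterval) := (atTop ×ˢ 𝓝 x ×ˢ 𝓝 0) ×ˢ 𝓝 s with hp
  obtain ⟨L, hL⟩ := hK.lipschitz
  have hfst : Tendsto (fun i : (ℕ × Skorokhod × ℝ) × unitInterval => i.1) p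
      (atTop ×ˢ 𝓝 x ×ˢ 𝓝 0) := tendsto_fst
  have hN : Tendsto (fun i : (ℕ × Skorokhod × ℝ) × unitInterval => i.1.1) p atTop :=
    tendsto_fst.comp hfst
  have hxe : Tendsto (fun i : (ℕ × Skorokhod × ℝ) × unitInterval => i.1.2) p (𝓝 x ×ˢ 𝓝 0) :=
    tendsto_snd.comp hfst
  have hy : Tendsto (fun i : (ℕ × Skorokhod × ℝ) × unitInterval => i.1.2.1) p (𝓝 x) :=
    tendsto_fst.comp hxe
  have he : Tendsto (fun i : (ℕ × Skorokhod × ℝ) × unitInterval => i.1.2.2) p (𝓝 0) :=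
    tendsto_snd.comp hxe
  have hxc : Continuous x.1 := by
    rw [show x.1 = fun s : unitInterval => σ * b (s : ℝ).toNNReal from funext hx]
    fun_prop
  have key := tendsto_kernel_average (p := p) hK.nonneg hL (N := fun i => i.1.1)
    (n := fun i => ⌊(i.1.1 : ℝ) * (i.2 : ℝ)⌋₊) (h := fun i => h i.1.1) hζ (fun i => h_pos _) s.2.1
    hN (Eventually.of_forall fun i => floor_mul_le _ _)
    (tendsto_floor_mul_div hN tendsto_snd) (h_lim.comp hN)
    (b := fun i j => i.1.2.1 (projIcc 0 1 zero_le_one ((j : ℝ) / i.1.1)) + i.1.2.2)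
    (f := fun r => σ * b r.toNNReal) (by fun_prop) (by simp [hb0]) (by
      intro ε hε
      have h1 := hy.eventually (Skorokhod.eventually_forall_abs_sub_lt hxc
        (half_pos hε))
      have h2 := Metric.tendsto_nhds.1 he (ε / 2) (half_pos hε)
      filter_upwards [h1, h2, hN.eventually (eventually_ge_atTop 1)] with i h1 h2 hi j hj
      have hN0 : (0 : ℝ) < i.1.1 := by exact_mod_cast hi
      have hmem : (j : ℝ) / i.1.1 ∈ Icc (0 : ℝ) 1 :=
        ⟨by positivity, (div_le_one hN0).2
          (by exact_mod_cast hj.le.trans (floor_mul_le i.1.1 i.2))⟩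
      have h3 := h1 (projIcc 0 1 zero_le_one ((j : ℝ) / i.1.1))
      rw [hx, projIcc_of_mem zero_le_one hmem] at h3
      rw [dist_zero_right, Real.norm_eq_abs] at h2
      rw [projIcc_of_mem zero_le_one hmem, add_sub_right_comm]
      exact (abs_add_le _ _).trans (by linarith))
  have hlim : limitProcess K ζ σ b s = (∫ r in (0 : ℝ)..s, K (ζ * (r - s)) * (σ * b r.toNNReal)) /
      (ζ * ∫ r in (0 : ℝ)..s, K (ζ * (r - s))) := by
    unfold limitProcess
    simp only [mul_left_comm (K _), intervalIntegral.integral_const_mul]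
  rw [hlim]
  refine key.congr' ?_
  filter_upwards [hN.eventually (eventually_ge_atTop 1)] with i hi
  rw [smootherPath_observations_apply K (h_pos _) hi]

theorem randomWalk_eq_add_sum {Ω : Type*} {Y u : ℕ → Ω → ℝ}
    (hY : ∀ n, 1 ≤ n → ∀ ω, Y (n + 1) ω = Y n ω + u n ω) (n : ℕ) (ω : Ω) :
    Y (n + 1) ω = Y 1 ω + ∑ i ∈ Finset.Icc 1 n, u i ω := by
  induction n with
  | zero => simp
  | succ n ih => rw [hY (n + 1) (by omega), ih, Finset.sum_Icc_succ_top (by omega), add_assoc]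

/-- The observed random walk is recovered from its rescaled partial sum path. -/
theorem randomWalk_eq_observations {Ω : Type*} {Y u : ℕ → Ω → ℝ}
    (hY : ∀ n, 1 ≤ n → ∀ ω, Y (n + 1) ω = Y n ω + u n ω) {N : ℕ} {ω : Ω} {x : Skorokhod}
    (hx : ∀ s : unitInterval,
      x s = (N : ℝ) ^ (-1 / 2 : ℝ) * ∑ i ∈ Finset.Icc 1 ⌊(N : ℝ) * (s : ℝ)⌋₊, u i ω)
    {i : ℕ} (hi : 1 ≤ i) (hiN : i ≤ N) :
    Y i ω = observations N x ((N : ℝ) ^ (-1 / 2 : ℝ) * Y 1 ω) i := by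
  obtain ⟨k, rfl⟩ := Nat.exists_eq_add_of_le' hi
  have hN0 : (0 : ℝ) < N := by exact_mod_cast hi.trans hiN
  have hmem : (k : ℝ) / N ∈ Icc (0 : ℝ) 1 :=
    ⟨by positivity, (div_le_one hN0).2 (by exact_mod_cast (Nat.le_succ k).trans hiN)⟩
  have h1 : (N : ℝ) ^ (1 / 2 : ℝ) * (N : ℝ) ^ (-1 / 2 : ℝ) = 1 := by
    rw [← Real.rpow_add hN0]
    norm_num
  unfold observations
  rw [Nat.cast_add, Nat.cast_one, add_sub_cancel_right, projIcc_of_mem zero_le_one hmem, hx]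
  simp only [mul_div_cancel₀ _ hN0.ne', Nat.floor_natCast]
  rw [← mul_add, ← mul_assoc, h1, one_mul, randomWalk_eq_add_sum hY, add_comm]

theorem aemeasurable_randomWalk {Ω : Type*} [MeasurableSpace Ω] {P : Measure Ω} {Y u : ℕ → Ω → ℝ}
    (hY : ∀ n, 1 ≤ n → ∀ ω, Y (n + 1) ω = Y n ω + u n ω) (hY_one : AEMeasurable (Y 1) P)
    (hu : ∀ n, 1 ≤ n → AEMeasurable (u n) P) (i : ℕ) (hi : 1 ≤ i) : AEMeasurable (Y i) P := by
  induction i, hi using Nat.le_induction with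
  | base => exact hY_one
  | succ n hn ih => exact (ih.add (hu n hn)).congr (Eventually.of_forall fun ω => (hY n hn ω).symm)

theorem tendstoInMeasure_rpow_mul {Ω : Type*} [MeasurableSpace Ω] {P : Measure Ω}
    [IsFiniteMeasure P] {y : Ω → ℝ} (hy : AEMeasurable y P) :
    TendstoInMeasure P (fun (N : ℕ) ω => (N : ℝ) ^ (-1 / 2 : ℝ) * y ω) atTop 0 := by
  refine tendstoInMeasure_of_tendsto_ae (fun N => (hy.const_mul _).aestronglyMeasurable)
    (Eventually.of_forall fun ω => ?_)
  have h1 : Tendsto (fun N : ℕ => (N : ℝ) ^ (-1 / 2 : ℝ)) atTop (𝓝 0) := by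
    have := (tendsto_rpow_neg_atTop (y := 1 / 2) (by norm_num)).comp
      (tendsto_natCast_atTop_atTop (R := ℝ))
    convert this using 2
    norm_num [neg_div]
  simpa using h1.mul_const (y ω)

open Classical in
/-- The limit process as a random element of the Skorokhod space, `0` off the event that its path
is continuous. -/
noncomputable def limitPath (K : ℝ → ℝ) (ζ σ : ℝ) (b : ℝ≥0 → ℝ) : Skorokhod :=
  if hc : Continuous fun s : unitInterval => limitProcess K ζ σ b s then
    ⟨_, isCadlag_of_continuous hc⟩ else stepPath 0 0

theorem limitPath_apply {K : ℝ → ℝ} {ζ σ : ℝ} {b : ℝ≥0 → ℝ}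
    (hc : Continuous fun s : unitInterval => limitProcess K ζ σ b s) (s : unitInterval) :
    limitPath K ζ σ b s = limitProcess K ζ σ b s := by
  have h1 : limitPath K ζ σ b = ⟨_, isCadlag_of_continuous hc⟩ := dif_pos hc
  rw [h1]

end RandomWalkSmoother

open RandomWalkSmoother in
theorem theorem1
    {Ω Ω' : Type*} [MeasurableSpace Ω] [MeasurableSpace Ω']
    (P : Measure Ω) [IsProbabilityMeasure P] (P' : Measure Ω') [IsProbabilityMeasure P']
    (B : ℝ≥0 → Ω' → ℝ) (hB : IsBrownianReal B P')
    (u : ℕ → Ω → ℝ) (σ : ℝ) (hA : RandomWalkSmoother.AssumptionA u σ B P P')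
    (K : ℝ → ℝ) (hK : RandomWalkSmoother.AssumptionK K)
    (h : ℕ → ℝ) (h_pos : ∀ N, 0 < h N)
    (ζ : ℝ) (hζ : 1 ≤ ζ) (h_lim : Tendsto (fun N : ℕ => (N : ℝ) / h N) atTop (𝓝 ζ))
    (Y : ℕ → Ω → ℝ) (hY_one : AEMeasurable (Y 1) P)
    (hY_succ : ∀ n, 1 ≤ n → ∀ ω, Y (n + 1) ω = Y n ω + u n ω) :
    TendstoInDistribution
      (fun (N : ℕ) ω =>
        h N * (N : ℝ) ^ (-3 / 2 : ℝ) * RandomWalkSmoother.smoother K (h N) (fun i => Y i ω) N)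
      atTop
      (fun ω => (σ * ∫ r in (0 : ℝ)..1, K (ζ * (r - 1)) * B r.toNNReal ω) /
        (ζ * ∫ r in (0 : ℝ)..1, K (ζ * (r - 1))))
      (fun _ => P) P' ∧
    RandomWalkSmoother.TendstoWeaklyInD
      (fun N ω s => h N * (N : ℝ) ^ (-3 / 2 : ℝ) *
        RandomWalkSmoother.smoother K (h N) (fun i => Y i ω) ⌊(N : ℝ) * (s : ℝ)⌋₊)
      (fun ω s => RandomWalkSmoother.limitProcess K ζ σ (fun t => B t ω) s) P P' ∧
    ∀ᵐ ω ∂P', Continuous fun s : unitInterval =>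
      RandomWalkSmoother.limitProcess K ζ σ (fun t => B t ω) s := by
  have hζ0 : 0 < ζ := zero_lt_one.trans_le hζ
  obtain ⟨XD, ZD, hXD, hZD, hconv⟩ := hA.invariance
  have hboth : ∀ᵐ ω ∂P', Continuous (fun s : unitInterval =>
        limitProcess K ζ σ (fun t => B t ω) s) ∧
      TendstoUniformly (fun (q : ℕ × Skorokhod × ℝ) (s : unitInterval) =>
          smootherPath K (h q.1) q.1 (observations q.1 q.2.1 q.2.2) s)
        (fun s : unitInterval => limitProcess K ζ σ (fun t => B t ω) s)
        (atTop ×ˢ 𝓝 (ZD ω) ×ˢ 𝓝 0) := by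
    filter_upwards [hB.cont, hB.eval_zero_ae_eq_zero, hZD] with ω hc h0 hZ
    exact continuous_limitProcess_and_tendstoUniformly hK h_pos hζ0 h_lim hc h0 hZ
  have hg : ∀ᵐ ω ∂P', Tendsto (fun q : ℕ × Skorokhod × ℝ =>
      smootherPath K (h q.1) q.1 (observations q.1 q.2.1 q.2.2))
      (atTop ×ˢ 𝓝 (ZD ω) ×ˢ 𝓝 0) (𝓝 (limitPath K ζ σ fun t => B t ω)) := by
    filter_upwards [hboth] with ω hω
    refine Skorokhod.tendsto_of_tendstoUniformly ?_
    rw [show (limitPath K ζ σ fun t => B t ω).1 =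
      fun s : unitInterval => limitProcess K ζ σ (fun t => B t ω) s from
        funext (limitPath_apply hω.1)]
    exact hω.2
  have hW : AEMeasurable (fun ω => limitPath K ζ σ fun t => B t ω) P' := by
    refine aemeasurable_of_tendsto_metrizable_ae atTop
      (f := fun N ω => smootherPath K (h N) N (observations N (ZD ω) 0)) (fun N => ?_) ?_
    · have h1 := aemeasurable_smootherPath (P := P') K (h N) N
        (y := fun i ω => (N : ℝ) ^ (1 / 2 : ℝ) *
          (σ * B ((projIcc 0 1 zero_le_one (((i : ℝ) - 1) / N) : unitInterval) : ℝ).toNNReal ω + 0))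
        fun i _ => (((hB.aemeasurable _).const_mul σ).add_const 0).const_mul _
      refine h1.congr ?_
      filter_upwards [hZD] with ω hω
      refine smootherPath_congr K _ fun i _ _ => ?_
      unfold observations
      rw [hω]
    · filter_upwards [hg] with ω hω
      exact hω.comp (tendsto_id.prodMk (tendsto_const_nhds.prodMk tendsto_const_nhds))
  have hweak : TendstoInDistribution (fun N ω => smootherPath K (h N) N fun i => Y i ω) atTop
      (fun ω => limitPath K ζ σ fun t => B t ω) (fun _ => P) P' := by
    refine tendstoInDistribution_of_continuous_convergence hconv
      (tendstoInMeasure_rpow_mul hY_one)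
      (g := fun N x e => smootherPath K (h N) N (observations N x e)) (fun N => ?_) hW
      (fun N => ?_) hg
    · exact aemeasurable_smootherPath K _ N
        (aemeasurable_randomWalk hY_succ hY_one fun n hn => (hA.memLp n hn).1.aemeasurable)
    · filter_upwards [hXD N] with ω hω
      exact smootherPath_congr K _ fun i hi hiN => randomWalk_eq_observations hY_succ hω hi hiN
  refine ⟨?_, ⟨_, _, fun N => ?_, ?_, hweak⟩, hboth.mono fun ω hω => hω.1⟩
  · refine (hweak.continuous_comp Skorokhod.continuous_eval_one).congr
      (fun N => Eventually.of_forall fun ω => ?_) ?_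
    · simp [smootherPath_apply]
    · filter_upwards [hboth] with ω hω
      simp only [Function.comp_apply]
      rw [limitPath_apply hω.1]
      simp [limitProcess]
  · exact Eventually.of_forall fun ω s => smootherPath_apply _ _ _ _ _
  · filter_upwards [hboth] with ω hω s
    exact limitPath_apply hω.1 s
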